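/- Let $n\ge 0$ be an integer and equip Euclidean spaces with their Euclidean norms $\|\cdot\|$. A map $w$ defined on a subset of $\mathbb{R}^n$ is called $1$-Lipschitz if $\|w(x)-w(y)\|\le\|x-y\|$ for all $x,y$ in its domain. For a set $S\subset\mathbb{R}^m$ let $\overline{\mathrm{Conv}}\,S$ denote the closed convex hull of $S$. Let $m\ge 2$ and let $v\colon\mathbb{R}^n\to\mathbb{R}^m$ be any map. The following three conditions are equivalent: (i) for every nonempty $A\subset\mathbb{R}^n$ and every $1$-Lipschitz map $u\colon A\to\mathbb{R}^m$ there is a $1$-Lipschitz map $\tilde u\colon\mathbb{R}^n\to\mathbb{R}^m$ with $\tilde u|_A=u$ such that for all $x\in\mathbb{R}^n$ $$v(x)-\tilde u(x)\in\overline{\mathrm{Conv}}\,\{v(z)-u(z) : z\in A\};$$ (ii) for every $\delta>0$, every $A\subset\mathbb{R}^n$ and every $1$-Lipschitz map $u\colon A\to\mathbb{R}^m$ with $\|v(z)-u(z)\|\le\delta$ for all $z\in A$, there is a $1$-Lipschitz map $\tilde u\colon\mathbb{R}^n\to\mathbb{R}^m$ with $\tilde u|_A=u$ such that $\|v(x)-\tilde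 u(x)\|\le\delta$ for all $x\in\mathbb{R}^n$; (iii) $v$ is affine and $1$-Lipschitz. In contrast, for $m=1$ every $1$-Lipschitz function $v\colon\mathbb{R}^n\to\mathbb{R}$ has property (ii) (with $\mathbb{R}$ in place of $\mathbb{R}^m$). -/

import Mathlib

/-- Every `1`-Lipschitz map `u` on a nonempty set `A` extends to a `1`-Lipschitz map `u'` on the
whole space such that `v - u'` takes values in the closed convex hull of `{v z - u z | z ∈ A}`. -/
def HasConvexHullExtension {E F : Type*} [NormedAddCommGroup E]
    [NormedAddCommGroup F] [NormedSpace ℝ F] (v : E → F) : Prop :=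
  ∀ (A : Set E), A.Nonempty → ∀ u : A → F, LipschitzWith 1 u →
    ∃ u' : E → F, LipschitzWith 1 u' ∧ (∀ z : A, u' z = u z) ∧
      ∀ x : E, v x - u' x ∈ closedConvexHull ℝ (Set.range fun z : A => v z - u z)

/-- Every `1`-Lipschitz map `u` on a set `A` at uniform distance at most `δ > 0` from `v` on `A`
extends to a `1`-Lipschitz map on the whole space at uniform distance at most `δ` from `v`. -/
def HasDistancePreservingExtension {E F : Type*} [NormedAddCommGroup E]
    [NormedAddCommGroup F] (v : E → F) : Prop :=
  ∀ δ : ℝ, 0 < δ → ∀ (A : Set E) (u : A → F), LipschitzWith 1 u →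
    (∀ z : A, ‖v z - u z‖ ≤ δ) →
    ∃ u' : E → F, LipschitzWith 1 u' ∧ (∀ z : A, u' z = u z) ∧ ∀ x : E, ‖v x - u' x‖ ≤ δ

/-! ### Affine contractions: relative Kirszbraun extension. -/

section OnePoint

variable {E F : Type*} [NormedAddCommGroup E] [InnerProductSpace ℝ E]
  [NormedAddCommGroup F] [InnerProductSpace ℝ F]

/-! For affine `v`, Zorn's lemma reduces extension to one new point, and compactness of balls in `F`
to finitely many constraints. These are solved in `exists_mem_convexHull_norm_sub_le` by a minimax
argument, where the parallel axis identity bounds the saddle value by 0. Closed balls are closed and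
convex, so the hull property yields the distance property. Conversely, a distance-preserving
extension forces `v` to be 1-Lipschitz and to preserve midpoints
(`HasDistancePreservingExtension.map_midpoint`); with continuity, `v` is affine. -/

/-- The weighted **parallel axis identity**. -/
theorem two_mul_sum_mul_norm_sub_sq {ι : Type*} [Fintype ι] (l : ι → ℝ) (hl : ∑ i, l i = 1)
    (u : ι → F) (w : F) :
    2 * ∑ i, l i * ‖u i - w‖ ^ 2 =
      (∑ i, ∑ j, l i * l j * ‖u i - u j‖ ^ 2) + 2 * ‖(∑ i, l i • u i) - w‖ ^ 2 := by
  have key : ∀ w' : F, ∑ i, l i * ‖u i - w'‖ ^ 2 =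
      ∑ i, l i * ‖u i‖ ^ 2 - 2 * inner ℝ (∑ i, l i • u i) w' + ‖w'‖ ^ 2 := by
    intro w'
    simp only [norm_sub_sq_real, mul_add, mul_sub, Finset.sum_add_distrib, Finset.sum_sub_distrib,
      sum_inner, real_inner_smul_left, Finset.mul_sum, ← Finset.sum_mul, hl, one_mul]
    congr 2
    exact Finset.sum_congr rfl fun i _ => by ring
  have hpair : ∑ i, ∑ j, l i * l j * ‖u i - u j‖ ^ 2 =
      2 * ∑ i, l i * ‖u i‖ ^ 2 - 2 * ‖∑ i, l i • u i‖ ^ 2 := by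
    have h1 : ∀ i, ∑ j, l i * l j * ‖u i - u j‖ ^ 2 =
        l i * (∑ j, l j * ‖u j‖ ^ 2) - 2 * inner ℝ (∑ j, l j • u j) (l i • u i)
          + l i * ‖u i‖ ^ 2 := by
      intro i
      have := key (u i)
      simp only [norm_sub_rev _ (u i)] at this
      simp only [mul_assoc, ← Finset.mul_sum, this, real_inner_smul_right]
      ring
    simp only [h1, Finset.sum_add_distrib, Finset.sum_sub_distrib, ← Finset.sum_mul, hl,
      ← Finset.mul_sum, ← inner_sum, real_inner_self_eq_norm_sq]
    ring
  rw [hpair, key, norm_sub_sq_real]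
  ring

/-- Finitely many balls `closedBall (u i) ‖z i‖` with `u i` at mutual distances at most those of
the `z i` have a common point in the convex hull of the points `u i - T (z i)`, for every linear
contraction `T`. -/
theorem exists_mem_convexHull_norm_sub_le {ι : Type*} [Fintype ι] [Nonempty ι] (T : E →ₗ[ℝ] F)
    (hT : ∀ w, ‖T w‖ ≤ ‖w‖) (z : ι → E) (u : ι → F) (hu : ∀ i j, ‖u i - u j‖ ≤ ‖z i - z j‖) :
    ∃ y ∈ convexHull ℝ (Set.range fun i => u i - T (z i)), ∀ i, ‖u i - y‖ ≤ ‖z i‖ := by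
  classical
  set C := convexHull ℝ (Set.range fun i => u i - T (z i)) with hC
  let f : F → (ι → ℝ) → ℝ := fun y l => ∑ i, l i * (‖u i - y‖ ^ 2 - ‖z i‖ ^ 2)
  have hconv : ∀ i, ConvexOn ℝ Set.univ fun y : F => ‖u i - y‖ ^ 2 - ‖z i‖ ^ 2 := fun i => by
    simp only [sub_eq_add_neg _ (‖z i‖ ^ 2)]
    refine (ConvexOn.pow ?_ (fun _ _ => norm_nonneg _) 2).add_const _
    simpa only [dist_eq_norm, norm_sub_rev] using convexOn_univ_dist (u i)
  obtain ⟨y, hy, l₀, hl₀, h⟩ : ∃ y ∈ C, ∃ l ∈ stdSimplex ℝ ι,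
      IsSaddlePointOn C (stdSimplex ℝ ι) f y l := by
    refine Sion.exists_isSaddlePointOn ?_ (convex_convexHull ℝ _)
      ((Set.finite_range _).isCompact_convexHull (𝕜 := ℝ)) ?_ ?_ (convex_stdSimplex ℝ ι)
      ⟨_, single_mem_stdSimplex ℝ (Classical.arbitrary ι)⟩ (isCompact_stdSimplex ℝ ι) ?_ ?_
    · exact (Set.range_nonempty _).convexHull
    · intro l _
      exact (by fun_prop : Continuous fun y => f y l).lowerSemicontinuous.lowerSemicontinuousOn _
    · intro l hl
      refine ConvexOn.quasiconvexOn ⟨convex_convexHull ℝ _, fun p _ q _ a b ha hb hab => ?_⟩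
      simp only [f, smul_eq_mul, Finset.mul_sum, ← Finset.sum_add_distrib]
      refine Finset.sum_le_sum fun i _ => ?_
      have := mul_le_mul_of_nonneg_left
        ((hconv i).2 (Set.mem_univ p) (Set.mem_univ q) ha hb hab) (hl.1 i)
      simp only [smul_eq_mul] at this
      linarith
    · intro y _
      exact (by fun_prop : Continuous fun l => f y l).upperSemicontinuous.upperSemicontinuousOn _
    · intro y _
      refine ConcaveOn.quasiconcaveOn ⟨convex_stdSimplex ℝ ι, fun l _ l' _ a b _ _ _ => le_of_eq ?_⟩
      simp only [f, Pi.add_apply, Pi.smul_apply, smul_eq_mul, Finset.mul_sum,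
        ← Finset.sum_add_distrib]
      exact Finset.sum_congr rfl fun i _ => by ring
  refine ⟨y, hy, fun i => ?_⟩
  have hx : ∑ j, l₀ j • (u j - T (z j)) ∈ C :=
    (convex_convexHull ℝ _).sum_mem (fun j _ => hl₀.1 j) hl₀.2
      fun j _ => subset_convexHull ℝ _ ⟨j, rfl⟩
  -- The saddle inequality bounds the `i`-th excess at `y` by the `l₀`-average excess at the
  -- barycentre of the `u j - T (z j)`.
  have h1 := h _ hx _ (single_mem_stdSimplex ℝ i)
  have h2 : f (∑ j, l₀ j • (u j - T (z j))) l₀ ≤ 0 := by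
    have e1 := two_mul_sum_mul_norm_sub_sq l₀ hl₀.2 u (∑ j, l₀ j • (u j - T (z j)))
    have e2 := two_mul_sum_mul_norm_sub_sq l₀ hl₀.2 z 0
    have e3 : (∑ j, l₀ j • u j) - ∑ j, l₀ j • (u j - T (z j)) = T (∑ j, l₀ j • z j) := by
      simp [smul_sub, Finset.sum_sub_distrib]
    have e4 : ∑ i, ∑ j, l₀ i * l₀ j * ‖u i - u j‖ ^ 2 ≤ ∑ i, ∑ j, l₀ i * l₀ j * ‖z i - z j‖ ^ 2 :=
      Finset.sum_le_sum fun i _ => Finset.sum_le_sum fun j _ =>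
        mul_le_mul_of_nonneg_left (pow_le_pow_left₀ (norm_nonneg _) (hu i j) 2)
          (mul_nonneg (hl₀.1 i) (hl₀.1 j))
    have e5 := pow_le_pow_left₀ (norm_nonneg _) (hT (∑ j, l₀ j • z j)) 2
    simp only [sub_zero] at e2
    rw [e3] at e1
    simp only [f, mul_sub, Finset.sum_sub_distrib] at e1 ⊢
    linarith
  have h3 : f y (Pi.single i 1) = ‖u i - y‖ ^ 2 - ‖z i‖ ^ 2 := by
    simp [f, Pi.single_apply]
  exact le_of_sq_le_sq (by linarith) (norm_nonneg _)

/-- The one-point extension step, for a graph `S` of a `1`-Lipschitz map. -/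
theorem exists_norm_sub_le_of_forall_mem [ProperSpace F] (v : E →ᵃ[ℝ] F) (hv : LipschitzWith 1 v)
    {K : Set F} (hK : Convex ℝ K) (hKc : IsClosed K) {S : Set (E × F)} (hS : S.Nonempty)
    (hL : ∀ p ∈ S, ∀ q ∈ S, ‖p.2 - q.2‖ ≤ ‖p.1 - q.1‖) (hSK : ∀ p ∈ S, v p.1 - p.2 ∈ K) (x : E) :
    ∃ y, v x - y ∈ K ∧ ∀ p ∈ S, ‖p.2 - y‖ ≤ ‖p.1 - x‖ := by
  classical
  obtain ⟨p₀, hp₀⟩ := hS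
  have hT : ∀ w, ‖v.linear w‖ ≤ ‖w‖ := fun w => by
    have := hv.dist_le_mul (w +ᵥ x) x
    rw [dist_eq_norm_vsub F, dist_eq_norm_vsub E, ← AffineMap.linearMap_vsub] at this
    simpa using this
  have hne := (isCompact_closedBall p₀.2 ‖p₀.1 - x‖).inter_iInter_nonempty
    (fun p : S => {y | v x - y ∈ K} ∩ {y | ‖p.1.2 - y‖ ≤ ‖p.1.1 - x‖})
    (fun p => (hKc.preimage (by fun_prop)).inter (isClosed_le (by fun_prop) (by fun_prop)))
    (fun s => by
      -- Including `p₀` puts the common point in the compact ball.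
      let s' := insert ⟨p₀, hp₀⟩ s
      have : Nonempty s' := ⟨⟨_, Finset.mem_insert_self _ _⟩⟩
      obtain ⟨y, hy, hy'⟩ := exists_mem_convexHull_norm_sub_le v.linear hT
        (fun p : s' => p.1.1.1 - x) (fun p : s' => p.1.1.2 - v x) fun p q => by
          simpa using hL _ p.1.2 _ q.1.2
      have hyK : -y ∈ K := by
        have hsub : convexHull ℝ (Set.range fun p : s' => p.1.1.2 - v x - v.linear (p.1.1.1 - x)) ⊆
            -K := by
          refine convexHull_min ?_ hK.neg
          rintro _ ⟨p, rfl⟩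
          have e : v.linear (p.1.1.1 - x) = v p.1.1.1 - v x := v.linearMap_vsub _ _
          have := hSK _ p.1.2
          simpa [e] using this
        exact hsub hy
      have hb : ∀ p ∈ s', ‖p.1.2 - (v x + y)‖ ≤ ‖p.1.1 - x‖ := fun p hp => by
        simpa [sub_sub] using hy' ⟨p, hp⟩
      refine ⟨v x + y, ?_, Set.mem_iInter₂.2 fun p hp => ⟨by simpa using hyK,
        hb p (Finset.mem_insert_of_mem hp)⟩⟩
      rw [mem_closedBall_iff_norm']
      exact hb _ (Finset.mem_insert_self _ _))
  obtain ⟨y, -, hy⟩ := hne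
  rw [Set.mem_iInter] at hy
  exact ⟨y, (hy ⟨p₀, hp₀⟩).1, fun p hp => (hy ⟨p, hp⟩).2⟩

/-- A **Kirszbraun theorem** relative to an affine contraction `v`. -/
theorem AffineMap.hasConvexHullExtension [ProperSpace F] (v : E →ᵃ[ℝ] F)
    (hv : LipschitzWith 1 v) : HasConvexHullExtension v := by
  intro A hA u hu
  set K := closedConvexHull ℝ (Set.range fun z : A => v z - u z) with hKdef
  let P : Set (Set (E × F)) := {S | (∀ p ∈ S, ∀ q ∈ S, ‖p.2 - q.2‖ ≤ ‖p.1 - q.1‖) ∧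
    ∀ p ∈ S, v p.1 - p.2 ∈ K}
  let G : Set (E × F) := Set.range fun z : A => ((z : E), u z)
  have hG : G ∈ P := by
    refine ⟨?_, ?_⟩
    · rintro _ ⟨a, rfl⟩ _ ⟨b, rfl⟩
      simpa [Subtype.dist_eq, dist_eq_norm] using hu.dist_le_mul a b
    · rintro _ ⟨a, rfl⟩
      exact subset_closedConvexHull ⟨a, rfl⟩
  obtain ⟨M, hGM, hM⟩ := zorn_subset_nonempty P (fun c hc hchain _ => by
    refine ⟨⋃₀ c, ⟨?_, ?_⟩, fun s hs => Set.subset_sUnion_of_mem hs⟩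
    · rintro p ⟨s, hs, hp⟩ q ⟨t, ht, hq⟩
      rcases hchain.total hs ht with hst | hst
      · exact (hc ht).1 p (hst hp) q hq
      · exact (hc hs).1 p hp q (hst hq)
    · rintro p ⟨s, hs, hp⟩
      exact (hc hs).2 p hp) G hG
  have hMne : M.Nonempty := by
    obtain ⟨a, ha⟩ := hA
    exact ⟨_, hGM ⟨⟨a, ha⟩, rfl⟩⟩
  have htot : ∀ x, ∃ y, (x, y) ∈ M := by
    intro x
    obtain ⟨y, hyK, hy⟩ := exists_norm_sub_le_of_forall_mem v hv convex_closedConvexHull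
      isClosed_closedConvexHull hMne hM.prop.1 hM.prop.2 x
    refine ⟨y, hM.le_of_ge (y := insert (x, y) M) ⟨?_, ?_⟩ (Set.subset_insert _ _)
      (Set.mem_insert _ _)⟩
    · rintro p (rfl | hp) q (rfl | hq)
      · simp
      · simpa only [norm_sub_rev] using hy q hq
      · exact hy p hp
      · exact hM.prop.1 p hp q hq
    · rintro p (rfl | hp)
      · exact hyK
      · exact hM.prop.2 p hp
  choose w hw using htot
  refine ⟨w, LipschitzWith.of_dist_le_mul fun x y => ?_, fun z => ?_, fun x => hM.prop.2 _ (hw x)⟩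
  · simpa [dist_eq_norm] using hM.prop.1 _ (hw x) _ (hw y)
  · have := hM.prop.1 _ (hw z) _ (hGM ⟨z, rfl⟩)
    simpa [sub_eq_zero] using this

end OnePoint

/-! ### Consequences of the extension properties; the scalar case. -/

section Converse

theorem HasConvexHullExtension.lipschitzWith {E F : Type*} [NormedAddCommGroup E]
    [NormedAddCommGroup F] [NormedSpace ℝ F] {v : E → F} (h : HasConvexHullExtension v) :
    LipschitzWith 1 v := by
  -- With `u = v` on one point the hull is `{0}`, so the extension is `v` itself.
  obtain ⟨u', hu', -, hx⟩ := h {0} (Set.singleton_nonempty 0) (fun z => v z)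
    (fun x y => by simp [Subsingleton.elim x y])
  have hsub : closedConvexHull ℝ (Set.range fun z : ({0} : Set E) => v z - v z) ⊆ {0} :=
    closedConvexHull_min (by rintro _ ⟨z, rfl⟩; simp) (convex_singleton 0) isClosed_singleton
  have : v = u' := funext fun x => sub_eq_zero.1 (hsub (hx x))
  rwa [this]

theorem HasConvexHullExtension.hasDistancePreservingExtension {E F : Type*}
    [NormedAddCommGroup E] [NormedAddCommGroup F] [NormedSpace ℝ F] {v : E → F}
    (h : HasConvexHullExtension v) : HasDistancePreservingExtension v := by
  intro δ hδ A u hu hd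
  rcases A.eq_empty_or_nonempty with rfl | hA
  · exact ⟨v, h.lipschitzWith, fun z => z.2.elim, fun x => by simpa using hδ.le⟩
  obtain ⟨u', hu', he, hx⟩ := h A hA u hu
  refine ⟨u', hu', he, fun x => ?_⟩
  have hsub : closedConvexHull ℝ (Set.range fun z : A => v z - u z) ⊆ Metric.closedBall 0 δ :=
    closedConvexHull_min (by rintro _ ⟨z, rfl⟩; simpa using hd z) (convex_closedBall 0 δ)
      Metric.isClosed_closedBall
  simpa using hsub (hx x)

theorem HasDistancePreservingExtension.lipschitzWith {E F : Type*} [NormedAddCommGroup E]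
    [NormedAddCommGroup F] {v : E → F} (h : HasDistancePreservingExtension v) :
    LipschitzWith 1 v := by
  refine LipschitzWith.of_dist_le_mul fun x y => le_of_forall_pos_le_add fun ε hε => ?_
  obtain ⟨w, hw, -, hx⟩ := h (ε / 2) (half_pos hε) ∅ (fun z => z.2.elim)
    (fun x y => by simp [Subsingleton.elim x y]) (fun z => z.2.elim)
  have h1 := dist_triangle4 (v x) (w x) (w y) (v y)
  have h2 := hx x
  have h3 := hx y
  rw [← dist_eq_norm] at h2 h3
  rw [dist_comm (v y)] at h3
  linarith [hw.dist_le_mul x y]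

/-- On a pair of points at equal distances, a `1`-Lipschitz map preserves the midpoint. -/
theorem LipschitzWith.map_midpoint_of_dist_eq {E F : Type*} [NormedAddCommGroup E]
    [NormedSpace ℝ E] [NormedAddCommGroup F] [NormedSpace ℝ F] [StrictConvexSpace ℝ F] {w : E → F}
    (hw : LipschitzWith 1 w) {a b : E} (hab : dist (w a) (w b) = dist a b) :
    w (midpoint ℝ a b) = midpoint ℝ (w a) (w b) := by
  have h1 := hw.dist_le_mul a (midpoint ℝ a b)
  have h2 := hw.dist_le_mul (midpoint ℝ a b) b
  have h3 := dist_triangle (w a) (w (midpoint ℝ a b)) (w b)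
  simp only [dist_left_midpoint, dist_midpoint_right, NNReal.coe_one, one_mul,
    Real.norm_ofNat] at h1 h2
  refine eq_midpoint_of_dist_eq_half ?_ ?_ <;> linarith

theorem exists_norm_add_smul_eq {F : Type*} [NormedAddCommGroup F] [NormedSpace ℝ F]
    {p s : F} (hs : s ≠ 0) {r : ℝ} (hr : ‖p‖ ≤ r) : ∃ t : ℝ, ‖p + t • s‖ = r := by
  have hs' : 0 < ‖s‖ := norm_pos_iff.2 hs
  have hT : r ≤ ‖p + ((r + ‖p‖) / ‖s‖) • s‖ := by
    have h1 : ‖((r + ‖p‖) / ‖s‖) • s‖ = r + ‖p‖ := by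
      rw [norm_smul, Real.norm_of_nonneg (by positivity [(norm_nonneg p).trans hr]),
        div_mul_cancel₀ _ hs'.ne']
    have h2 := norm_sub_le_norm_add (((r + ‖p‖) / ‖s‖) • s) p
    rw [add_comm p]
    linarith
  obtain ⟨t, ht⟩ := mem_range_of_exists_le_of_exists_ge
    (f := fun t : ℝ => ‖p + t • s‖) (by fun_prop) ⟨0, by simpa using hr⟩ ⟨_, hT⟩
  exact ⟨t, ht⟩

theorem exists_ne_zero_inner_eq_zero {F : Type*} [NormedAddCommGroup F] [InnerProductSpace ℝ F]
    [FiniteDimensional ℝ F] (hF : 2 ≤ Module.finrank ℝ F) (w : F) :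
    ∃ s : F, s ≠ 0 ∧ inner ℝ w s = 0 := by
  have h1 := (ℝ ∙ w).finrank_add_finrank_orthogonal
  have h2 : Module.finrank ℝ (ℝ ∙ w) ≤ 1 := by simpa using finrank_span_le_card (R := ℝ) {w}
  have : Nontrivial (ℝ ∙ w)ᗮ := Module.nontrivial_of_finrank_pos (R := ℝ) (by omega)
  obtain ⟨s, hs⟩ := exists_ne (0 : (ℝ ∙ w)ᗮ)
  exact ⟨s, by simpa using hs, Submodule.mem_orthogonal_singleton_iff_inner_right.1 s.2⟩

/-- Let `w` be the midpoint defect. Shift both endpoint values by `-c • w` and spread them along `s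
⟂ w` until their distance is `dist a b`. Strict convexity then dictates any extension at the
midpoint, where the error is `(1 + c) * ‖w‖`; since `s ⟂ w`, the endpoint error `δ` is smaller for
large `c`. Dimension at least 2 provides the direction of `s`. -/
theorem HasDistancePreservingExtension.map_midpoint {E F : Type*} [NormedAddCommGroup E]
    [NormedSpace ℝ E] [NormedAddCommGroup F] [InnerProductSpace ℝ F] [FiniteDimensional ℝ F]
    (hF : 2 ≤ Module.finrank ℝ F) {v : E → F} (h : HasDistancePreservingExtension v) (a b : E) :
    v (midpoint ℝ a b) = midpoint ℝ (v a) (v b) := by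
  rcases eq_or_ne a b with rfl | hab
  · simp
  by_contra hne
  set w := v (midpoint ℝ a b) - midpoint ℝ (v a) (v b) with hw
  have hw0 : 0 < ‖w‖ := norm_pos_iff.2 (sub_ne_zero.2 hne)
  obtain ⟨s₀, hs₀, hws₀⟩ := exists_ne_zero_inner_eq_zero hF w
  obtain ⟨t, ht⟩ := exists_norm_add_smul_eq (p := v a - v b) hs₀ (r := dist a b) (by
    simpa [dist_eq_norm] using h.lipschitzWith.dist_le_mul a b)
  set s := t • s₀ with hs
  have hws : inner ℝ w s = 0 := by rw [hs, real_inner_smul_right, hws₀, mul_zero]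
  -- the perturbation of size `c` along `-w`
  obtain ⟨c, hc⟩ : ∃ c : ℝ, c = 1 + ‖s‖ ^ 2 / ‖w‖ ^ 2 := ⟨_, rfl⟩
  have hc0 : 0 < c := by rw [hc]; positivity
  obtain ⟨δ, hδ⟩ : ∃ δ : ℝ, δ = √(c ^ 2 * ‖w‖ ^ 2 + ‖s‖ ^ 2 / 4) := ⟨_, rfl⟩
  have hδ0 : 0 < δ := by rw [hδ]; positivity
  have hδ2 : δ ^ 2 = c ^ 2 * ‖w‖ ^ 2 + ‖s‖ ^ 2 / 4 := by
    rw [hδ]; exact Real.sq_sqrt (by positivity)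
  have hnorm : ∀ r : ℝ, ‖c • w + r • s‖ ^ 2 = c ^ 2 * ‖w‖ ^ 2 + r ^ 2 * ‖s‖ ^ 2 := fun r => by
    rw [norm_add_sq_real, real_inner_smul_left, real_inner_smul_right, hws, norm_smul, norm_smul,
      mul_pow, mul_pow, Real.norm_eq_abs, Real.norm_eq_abs, sq_abs, sq_abs]
    ring
  classical
  let g : E → F := fun x => if x = a then v a - c • w + (2⁻¹ : ℝ) • s
    else v b - c • w - (2⁻¹ : ℝ) • s
  have hga : g a = v a - c • w + (2⁻¹ : ℝ) • s := if_pos rfl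
  have hgb : g b = v b - c • w - (2⁻¹ : ℝ) • s := if_neg hab.symm
  have hgab : dist (g a) (g b) = dist a b := by
    rw [← ht, dist_eq_norm, hga, hgb]
    congr 1
    module
  have hglip : ∀ x ∈ ({a, b} : Set E), ∀ y ∈ ({a, b} : Set E), dist (g x) (g y) ≤ dist x y := by
    simp [hgab, dist_comm (g b), dist_comm b]
  have hgδ : ∀ z ∈ ({a, b} : Set E), ‖v z - g z‖ ≤ δ := by
    simp only [Set.mem_insert_iff, Set.mem_singleton_iff, forall_eq_or_imp, forall_eq]
    constructor <;> refine le_of_sq_le_sq (le_of_eq ?_) hδ0.le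
    · rw [hδ2, hga, show v a - (v a - c • w + (2⁻¹ : ℝ) • s) = c • w + (-2⁻¹ : ℝ) • s by module,
        hnorm]
      ring
    · rw [hδ2, hgb, show v b - (v b - c • w - (2⁻¹ : ℝ) • s) = c • w + (2⁻¹ : ℝ) • s by module,
        hnorm]
      ring
  obtain ⟨u', hu', he, hx⟩ := h δ hδ0 {a, b} (fun z => g z)
    (LipschitzWith.of_dist_le_mul fun x y => by
      simpa [Subtype.dist_eq] using hglip x x.2 y y.2) (fun z => hgδ z z.2)
  have hea : u' a = g a := he ⟨a, by simp⟩
  have heb : u' b = g b := he ⟨b, by simp⟩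
  have hmid := hu'.map_midpoint_of_dist_eq (a := a) (b := b) (by rw [hea, heb, hgab])
  have hle := hx (midpoint ℝ a b)
  have hdiff : v (midpoint ℝ a b) - u' (midpoint ℝ a b) = (1 + c) • w := by
    have h1 : midpoint ℝ (g a) (g b) = midpoint ℝ (v a) (v b) - c • w := by
      rw [hga, hgb, midpoint_eq_smul_add, midpoint_eq_smul_add, invOf_eq_inv]
      module
    rw [hmid, hea, heb, h1, hw]
    module
  rw [hdiff] at hle
  have h2 := pow_le_pow_left₀ (norm_nonneg _) hle 2
  rw [hδ2, norm_smul, mul_pow, Real.norm_eq_abs, sq_abs] at h2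
  -- `h2` amounts to `(1 + 2 * c) * ‖w‖ ^ 2 ≤ ‖s‖ ^ 2 / 4`, which this choice of `c` violates.
  have h3 : c * ‖w‖ ^ 2 = ‖w‖ ^ 2 + ‖s‖ ^ 2 := by rw [hc]; field_simp
  nlinarith [sq_nonneg ‖s‖, pow_pos hw0 2]

/-- Every real `1`-Lipschitz function admits distance preserving extensions: truncate the McShane
extension. -/
theorem LipschitzWith.hasDistancePreservingExtension {E : Type*} [NormedAddCommGroup E]
    {v : E → ℝ} (hv : LipschitzWith 1 v) : HasDistancePreservingExtension v := by
  intro δ hδ A u hu hd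
  obtain ⟨g, hg, hge⟩ : ∃ g : E → ℝ, LipschitzWith 1 g ∧ ∀ z : A, g z = u z := by
    classical
    let f : E → ℝ := fun x => if hx : x ∈ A then u ⟨x, hx⟩ else 0
    have hf : ∀ z : A, f z = u z := fun z => dif_pos z.2
    obtain ⟨g, hg, hfg⟩ := LipschitzOnWith.extend_real (f := f) (s := A) (K := 1) (by
      rw [lipschitzOnWith_iff_restrict]
      convert hu using 1
      exact funext hf)
    exact ⟨g, hg, fun z => by rw [← hfg z.2, hf]⟩
  have hadd : ∀ c : ℝ, LipschitzWith 1 fun x => v x + c := fun c => by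
    simpa using hv.add (LipschitzWith.const c)
  refine ⟨fun x => max (v x + -δ) (min (v x + δ) (g x)), ?_, fun z => ?_, fun x => ?_⟩
  · simpa using (hadd (-δ)).max ((hadd δ).min hg)
  · have := abs_le.1 (hd z)
    simp only [hge]
    rw [min_eq_right (by linarith), max_eq_right (by linarith)]
  · rw [Real.norm_eq_abs, abs_sub_comm, abs_le]
    have h1 := le_max_left (v x + -δ) (min (v x + δ) (g x))
    have h2 : max (v x + -δ) (min (v x + δ) (g x)) ≤ v x + δ :=
      max_le (by linarith) (min_le_left _ _)
    constructor <;> linarith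

end Converse

theorem mainTheorem1 (n : ℕ) :
    (∀ m : ℕ, 2 ≤ m → ∀ v : EuclideanSpace ℝ (Fin n) → EuclideanSpace ℝ (Fin m),
      List.TFAE [
        HasConvexHullExtension v,
        HasDistancePreservingExtension v,
        (∃ f : EuclideanSpace ℝ (Fin n) →ᵃ[ℝ] EuclideanSpace ℝ (Fin m), ⇑f = v) ∧
          LipschitzWith 1 v]) ∧
    (∀ v : EuclideanSpace ℝ (Fin n) → ℝ, LipschitzWith 1 v →
      HasDistancePreservingExtension v) := by
  refine ⟨fun m hm v => ?_, fun v hv => hv.hasDistancePreservingExtension⟩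
  tfae_have 1 → 2 := fun h => h.hasDistancePreservingExtension
  tfae_have 2 → 3 := fun h => ⟨⟨AffineMap.ofMapMidpoint v
    (h.map_midpoint (by simpa using hm)) h.lipschitzWith.continuous, rfl⟩, h.lipschitzWith⟩
  tfae_have 3 → 1 := by
    rintro ⟨⟨f, rfl⟩, hf⟩
    exact f.hasConvexHullExtension hf
  tfae_finish
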